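/- **Theorem (Stokes' theorem in open sets).** Let $E=\mathbb{R}^n$ carry a fixed inner product, let $U\subset E$ be open, and let $0\le k\le n-1$. *Notation.* A Dirac $m$-chain in $U$ is a finite formal sum $A=\sum_i(p_i;\alpha_i)$ with $p_i\in U$, $\alpha_i\in\Lambda_m(E)$ (a finitely supported section of $\Lambda_m$ over $U$). The mass $\|\alpha\|$ of $\alpha\in\Lambda_m(E)$ is the infimum of $\sum_i\|\alpha_i\|$ over decompositions $\alpha=\sum_i\alpha_i$ into simple $m$-vectors, where $\|v_1\wedge\dots\wedge v_m\|=\sqrt{\det\langle v_a,v_b\rangle}$ (and $\|c\|=|c|$ for $m=0$). For $\sigma=u_1\circ\dots\circ u_j$ put $\Delta_\sigma(p;\alpha)=(T_{u_1}-I)\cdots(T_{u_j}-I)(p;\alpha)$, where $T_u(p;\alpha)=(p+u;\alpha)$, and $\|\sigma\|=\|u_1\|\cdots\|u_j\|$; such a difference chain of order $j$ is inside $U$ if the convex hull of its support is contained in $U$. For finite $r\ge 0$, let $$\|A\|_{B^{r,U}}=\inf\Big\{\sum_i\|\sigma_i\|\|\alpha_i\| : A=\sum_i\Delta_{\sigma_i}(p_i;\alpha_i),\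 \text{each term inside } U \text{ and of order at most } r\Big\},$$ let $\hat{\mathcal B}_m^r(U)$ be the completion of the Dirac $m$-chains in $U$ in this norm, and let $\mathcal B_m^r(U)$ be the space of linear functionals $\omega$ on Dirac $m$-chains in $U$ for which $|\omega(\Delta_\sigma(p;\alpha))|\le C\|\sigma\|\|\alpha\|$ with a constant $C$ for all difference chains of order at most $r$ inside $U$. Let $\hat{\mathcal B}_m^\infty(U)=\varinjlim_r\hat{\mathcal B}_m^r(U)$ with the locally convex inductive limit topology, along the linking maps $\hat{\mathcal B}_m^r(U)\to\hat{\mathcal B}_m^s(U)$, $r\le s$, that extend the identity of Dirac chains, and let $\mathcal B_m^\infty(U)=\bigcap_r\mathcal B_m^r(U)$. For $J\in\hat{\mathcal B}_m^r(U)$ and $\omega\in\mathcal B_m^r(U)$, $0\le r\le\infty$, $\int_J\omega$ denotes the value at $J$ of the continuous extension of $\omega$ from Dirac chains. For an orthonormal basis $(e_i)$ of $E$ put $$\partial(p;\alpha)=\sum_{i=1}^nP_{e_i}(p;E^\dagger_{e_i}\alpha),\qquad P_v(p;\beta)=\lim_{t\to0}\tfrac1t\big((p+tv;\beta)-(p;\beta)\big),$$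 $$E_v^\dagger(v_0\wedge\dots\wedge v_k)=\sum_{i=0}^k(-1)^i\langle v,v_i\rangle\, v_0\wedge\cdots\widehat{v_i}\cdots\wedge v_k,$$ and let $d$ be the exterior derivative of differential forms on $U$. *Claim.* Let $2\le r\le\infty$ (with $r-1=\infty$ if $r=\infty$). 1. For finite $r$, the limits $P_v(p;\beta)$ exist in $\hat{\mathcal B}_k^r(U)$ for all $p\in U$, $v\in E$, $\beta\in\Lambda_k(E)$, and $\partial$ extends from Dirac chains to a continuous linear operator $\partial:\hat{\mathcal B}_{k+1}^{r-1}(U)\to\hat{\mathcal B}_k^{r}(U)$. These operators induce a continuous linear operator $\partial:\hat{\mathcal B}_{k+1}^{\infty}(U)\to\hat{\mathcal B}_k^{\infty}(U)$. 2. Every $\omega\in\mathcal B_k^r(U)$ is differentiable on $U$, and $d\omega\in\mathcal B_{k+1}^{r-1}(U)$. 3. For all $J\in\hat{\mathcal B}_{k+1}^{r-1}(U)$ and $\omega\in\mathcal B_k^r(U)$, $$\int_{\partial J}\omega=\int_Jd\omega .$$ Moreover, for $J\in\hat{\mathcal B}_{k+1}^{0}(U)$, with $\partial J\in\hat{\mathcal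 B}_k^2(U)$ defined through the linking map $\hat{\mathcal B}_{k+1}^{0}(U)\to\hat{\mathcal B}_{k+1}^{1}(U)$, one has $\int_{\partial J}\omega=\int_Jd\omega$ for all $\omega\in\mathcal B_k^2(U)$. The forms are only required to be regular inside $U$; they need not extend continuously across the frontier of $U$. -/

import Mathlib

open Filter Topology UniformSpace
open scoped RealInnerProductSpace

noncomputable section

namespace DiffChains

/-! ### Infimum of the total cost over finite decompositions -/

section Atomic

variable {ι V : Type*} [AddCommGroup V]

/-- The set of total costs `∑ w (iⱼ)` over all finite decompositions `x = ∑ a (iⱼ)`. -/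
def costSet (a : ι → V) (w : ι → ℝ) (x : V) : Set ℝ :=
  {c | ∃ l : List ι, (l.map a).sum = x ∧ (l.map w).sum = c}

theorem costSet_nonneg {a : ι → V} {w : ι → ℝ} (hw : ∀ i, 0 ≤ w i) {x : V} {c : ℝ}
    (hc : c ∈ costSet a w x) : 0 ≤ c := by
  obtain ⟨l, -, rfl⟩ := hc
  apply List.sum_nonneg
  intro y hy
  obtain ⟨i, -, rfl⟩ := List.mem_map.1 hy
  exact hw i

theorem costSet_bddBelow {a : ι → V} {w : ι → ℝ} (hw : ∀ i, 0 ≤ w i) (x : V) :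
    BddBelow (costSet a w x) :=
  ⟨0, fun _ hc => costSet_nonneg hw hc⟩

variable [Module ℝ V]

theorem exists_costSet_smul {a : ι → V} {w : ι → ℝ}
    (hs : ∀ (t : ℝ) (i : ι), ∃ j, a j = t • a i ∧ w j ≤ |t| * w i) (t : ℝ) (l : List ι) :
    ∃ l' : List ι, (l'.map a).sum = t • (l.map a).sum ∧
      (l'.map w).sum ≤ |t| * (l.map w).sum := by
  induction l with
  | nil => exact ⟨[], by simp, by simp⟩
  | cons i l ih =>
    obtain ⟨l', h1, h2⟩ := ih
    obtain ⟨j, h3, h4⟩ := hs t i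
    refine ⟨j :: l', ?_, ?_⟩
    · simp [h1, h3, smul_add]
    · simp only [List.map_cons, List.sum_cons, mul_add]
      exact add_le_add h4 h2

/-- The seminorm `x ↦ inf {∑ w (iⱼ) : x = ∑ a (iⱼ)}`. -/
def atomicSeminorm (a : ι → V) (w : ι → ℝ) (hw : ∀ i, 0 ≤ w i)
    (hspan : ∀ x : V, ∃ l : List ι, (l.map a).sum = x)
    (hs : ∀ (t : ℝ) (i : ι), ∃ j, a j = t • a i ∧ w j ≤ |t| * w i) : Seminorm ℝ V :=
  Seminorm.ofSMulLE (fun x => sInf (costSet a w x))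
    (by
      apply le_antisymm
      · exact csInf_le (costSet_bddBelow hw 0) ⟨[], by simp, by simp⟩
      · exact Real.sInf_nonneg fun c hc => costSet_nonneg hw hc)
    (by
      intro x y
      have hne : ∀ z : V, (costSet a w z).Nonempty := fun z => by
        obtain ⟨l, hl⟩ := hspan z
        exact ⟨_, l, hl, rfl⟩
      rw [← csInf_add (hne x) (costSet_bddBelow hw x) (hne y) (costSet_bddBelow hw y)]
      apply csInf_le_csInf (costSet_bddBelow hw _) ((hne x).add (hne y))
      rintro _ ⟨_, ⟨l, rfl, rfl⟩, _, ⟨l', rfl, rfl⟩, rfl⟩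
      exact ⟨l ++ l', by simp, by simp⟩)
    (by
      intro t x
      have hne : (costSet a w x).Nonempty := by
        obtain ⟨l, hl⟩ := hspan x
        exact ⟨_, l, hl, rfl⟩
      apply le_of_forall_pos_le_add
      intro ε hε
      obtain ⟨c, ⟨l, rfl, rfl⟩, hc⟩ :=
        exists_lt_of_csInf_lt hne (lt_add_of_pos_right (sInf (costSet a w x))
          (show 0 < ε / (|t| + 1) by positivity))
      obtain ⟨l', h1, h2⟩ := exists_costSet_smul hs t l
      have h3 : sInf (costSet a w (t • (l.map a).sum)) ≤ (l'.map w).sum :=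
        csInf_le (costSet_bddBelow hw _) ⟨l', h1, rfl⟩
      have h4 : |t| * (ε / (|t| + 1)) ≤ ε := by
        rw [mul_div_assoc', div_le_iff₀ (by positivity)]
        nlinarith [abs_nonneg t]
      calc sInf (costSet a w (t • (l.map a).sum)) ≤ |t| * (l.map w).sum := h3.trans h2
        _ ≤ |t| * (sInf (costSet a w (l.map a).sum) + ε / (|t| + 1)) :=
            mul_le_mul_of_nonneg_left hc.le (abs_nonneg t)
        _ ≤ ‖t‖ * sInf (costSet a w (l.map a).sum) + ε := by
            rw [Real.norm_eq_abs, mul_add]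
            linarith)

end Atomic

variable {E : Type*} [NormedAddCommGroup E] [InnerProductSpace ℝ E]

/-! ### Mass of `k`-vectors -/

theorem exists_simple_decomposition {k : ℕ} (α : ⋀[ℝ]^k E) :
    ∃ l : List (ℝ × (Fin k → E)),
      (l.map fun x => x.1 • exteriorPower.ιMulti ℝ k x.2).sum = α := by
  have hα : α ∈ Submodule.span ℝ (Set.range (exteriorPower.ιMulti ℝ k (M := E))) := by
    rw [exteriorPower.ιMulti_span]; trivial
  induction hα using Submodule.span_induction with
  | mem x hx =>
    obtain ⟨v, rfl⟩ := hx
    exact ⟨[(1, v)], by simp⟩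
  | zero => exact ⟨[], by simp⟩
  | add x y _ _ hx hy =>
    obtain ⟨l, rfl⟩ := hx
    obtain ⟨l', rfl⟩ := hy
    exact ⟨l ++ l', by simp⟩
  | smul t x _ hx =>
    obtain ⟨l, rfl⟩ := hx
    refine ⟨l.map fun x => (t * x.1, x.2), ?_⟩
    rw [List.smul_sum, List.map_map, List.map_map]
    congr 1
    apply List.map_congr_left
    intro x _
    simp [mul_smul]

/-- The mass of a `k`-vector: the infimum of `∑ ‖αᵢ‖` over all decompositions into simple
`k`-vectors `αᵢ = c • v₁ ∧ ⋯ ∧ vₖ`, where `‖αᵢ‖ = |c| √det ⟪vₐ, v_b⟫`. (The scalar `c` only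
matters for `k = 0`.) -/
def mass (k : ℕ) : Seminorm ℝ (⋀[ℝ]^k E) :=
  atomicSeminorm (ι := ℝ × (Fin k → E))
    (fun x => x.1 • exteriorPower.ιMulti ℝ k x.2)
    (fun x => |x.1| * √(Matrix.det (Matrix.of fun i j => ⟪x.2 i, x.2 j⟫)))
    (fun _ => by positivity)
    exists_simple_decomposition
    (fun t x => ⟨(t * x.1, x.2), by simp [mul_smul], by simp [abs_mul, mul_assoc]⟩)

/-! ### Dirac chains, difference chains and the `B^{r,U}` norms -/

/-- Dirac `k`-chains over a set of points `X` (either `E` or a subset of `E`): finitely supported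
functions from `X` to `k`-vectors. -/
def Sections (k : ℕ) (E : Type*) [NormedAddCommGroup E] [InnerProductSpace ℝ E] (X : Type*) :
    Type _ := X →₀ ⋀[ℝ]^k E

namespace Sections

variable {k : ℕ} {X : Type*}

instance : AddCommGroup (Sections k E X) := inferInstanceAs (AddCommGroup (X →₀ ⋀[ℝ]^k E))

instance : Module ℝ (Sections k E X) := inferInstanceAs (Module ℝ (X →₀ ⋀[ℝ]^k E))

/-- The underlying finitely supported function. -/
def toFinsupp : Sections k E X ≃ₗ[ℝ] (X →₀ ⋀[ℝ]^k E) := LinearEquiv.refl ℝ (X →₀ ⋀[ℝ]^k E)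

/-- The `k`-element `(p; α)`, linear in `α`. -/
def single (p : X) : ⋀[ℝ]^k E →ₗ[ℝ] Sections k E X :=
  toFinsupp.symm.toLinearMap ∘ₗ Finsupp.lsingle p

/-- The support of a Dirac chain. -/
def support (A : Sections k E X) : Set X := A.toFinsupp.support

/-- Restriction to `U` of a Dirac chain in the ambient space; for a chain supported in `U` this is
the same chain, regarded as a chain in `U`. -/
def restrict (U : Set X) : Sections k E X →ₗ[ℝ] Sections k E U :=
  toFinsupp.symm.toLinearMap ∘ₗ Finsupp.lsubtypeDomain U ∘ₗ toFinsupp.toLinearMap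

end Sections

/-- Translation `T_u (p; α) = (p + u; α)` of Dirac chains. -/
def translate {k : ℕ} (u : E) : Sections k E E →ₗ[ℝ] Sections k E E :=
  Sections.toFinsupp.symm.toLinearMap ∘ₗ Finsupp.lmapDomain _ ℝ (fun p => p + u) ∘ₗ
    Sections.toFinsupp.toLinearMap

/-- The `j`-difference `k`-chain `Δ_σ (p; α)`, `σ = u₁ ∘ ⋯ ∘ u_j`. -/
def diffChain {k : ℕ} : List E → E → ⋀[ℝ]^k E → Sections k E E
  | [], p, α => Sections.single p α
  | u :: σ, p, α => translate u (diffChain σ p α) - diffChain σ p α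

/-- Dirac `k`-chains in `U`, as a vector space. -/
abbrev DiracSpace (k : ℕ) (U : Set E) : Type _ := Sections k E U

/-- A difference chain `Δ_σ (p; α)` of order at most `r` that is inside `U`: the convex hull of
its support is contained in `U`. -/
structure InsideDiff (k r : ℕ) (U : Set E) where
  /-- the list of difference vectors -/
  σ : List E
  /-- the base point -/
  p : E
  /-- the `k`-vector -/
  α : ⋀[ℝ]^k E
  order_le : σ.length ≤ r
  inside : convexHull ℝ (diffChain σ p α).support ⊆ U

namespace InsideDiff

variable {k r : ℕ} {U : Set E}

/-- The Dirac chain `Δ_σ (p; α)`. -/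
def chain (d : InsideDiff k r U) : DiracSpace k U :=
  Sections.restrict U (diffChain d.σ d.p d.α)

/-- `‖σ‖ ‖α‖ = ‖u₁‖ ⋯ ‖u_j‖ ‖α‖`. -/
def cost (d : InsideDiff k r U) : ℝ :=
  (d.σ.map norm).prod * mass k d.α

theorem cost_nonneg (d : InsideDiff k r U) : 0 ≤ d.cost := by
  apply mul_nonneg _ (apply_nonneg _ _)
  apply List.prod_nonneg
  intro y hy
  obtain ⟨i, -, rfl⟩ := List.mem_map.1 hy
  exact norm_nonneg i

end InsideDiff

theorem diffChain_smul {k : ℕ} (t : ℝ) (σ : List E) (p : E) (α : ⋀[ℝ]^k E) :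
    diffChain σ p (t • α) = t • diffChain σ p α := by
  induction σ with
  | nil => simp [diffChain]
  | cons u σ ih => rw [diffChain, diffChain, ih, map_smul, smul_sub]

theorem exists_inside_decomposition {k : ℕ} (r : ℕ) {U : Set E} (A : DiracSpace k U) :
    ∃ l : List (InsideDiff k r U), (l.map InsideDiff.chain).sum = A := by
  induction A using Finsupp.induction_linear with
  | zero => exact ⟨[], rfl⟩
  | add f g hf hg =>
    obtain ⟨l, hl⟩ := hf
    obtain ⟨l', hl'⟩ := hg
    refine ⟨l ++ l', ?_⟩
    rw [List.map_append, List.sum_append, hl, hl']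
    rfl
  | single p α =>
    refine ⟨[⟨[], p, α, by simp, ?_⟩], ?_⟩
    · refine (convexHull_mono (t := {(p : E)}) ?_).trans ?_
      · rw [← Finset.coe_singleton]
        exact Finset.coe_subset.2 Finsupp.support_single_subset
      · simp
    · rw [List.map_singleton, List.sum_singleton]
      classical
      refine Finsupp.ext fun q => ?_
      change Finsupp.single (p : E) α (q : E) = Finsupp.single p α q
      simp [Finsupp.single_apply, Subtype.ext_iff]

/-- The norm `‖A‖_{B^{r,U}}` on Dirac chains: the infimum of `∑ ‖σᵢ‖ ‖αᵢ‖` over all ways to write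
`A = ∑ Δ_{σᵢ} (pᵢ; αᵢ)` as a sum of difference chains inside `U` of orders at most `r`. -/
def chainSeminorm (k r : ℕ) (U : Set E) : Seminorm ℝ (DiracSpace k U) :=
  atomicSeminorm InsideDiff.chain InsideDiff.cost InsideDiff.cost_nonneg
    (exists_inside_decomposition r)
    (fun t d => by
      refine ⟨⟨d.σ, d.p, t • d.α, d.order_le, ?_⟩, ?_, ?_⟩
      · refine (convexHull_mono ?_).trans d.inside
        rw [diffChain_smul]
        exact Finset.coe_subset.2 (Finsupp.support_smul (b := t)
          (g := (diffChain d.σ d.p d.α).toFinsupp))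
      · simp only [InsideDiff.chain, diffChain_smul, map_smul]
      · simp only [InsideDiff.cost, map_smul_eq_mul, Real.norm_eq_abs]
        exact le_of_eq (by ring))

/-- The space of Dirac `k`-chains in `U`, equipped with the `B^{r,U}` norm. -/
@[nolint unusedArguments]
def DiracChain (k _r : ℕ) (U : Set E) : Type _ := DiracSpace k U

namespace DiracChain

variable {k r : ℕ} {U : Set E}

instance : AddCommGroup (DiracChain k r U) := inferInstanceAs (AddCommGroup (DiracSpace k U))

instance : Module ℝ (DiracChain k r U) := inferInstanceAs (Module ℝ (DiracSpace k U))

/-- The identity map to the space of Dirac chains without a norm. -/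
def toSpace : DiracChain k r U ≃ₗ[ℝ] DiracSpace k U := LinearEquiv.refl ℝ (DiracSpace k U)

instance : SeminormedAddCommGroup (DiracChain k r U) :=
  AddGroupSeminorm.toSeminormedAddCommGroup
    ((chainSeminorm k r U).comp toSpace.toLinearMap).toAddGroupSeminorm

theorem norm_def (A : DiracChain k r U) : ‖A‖ = chainSeminorm k r U A.toSpace := rfl

instance : NormedSpace ℝ (DiracChain k r U) where
  norm_smul_le t A := by
    rw [norm_def, norm_def, map_smul, map_smul_eq_mul]

end DiracChain

/-- The `k`-element `(p; α)` as a Dirac chain in `U` (zero if `p ∉ U`). -/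
def element {k : ℕ} (r : ℕ) (U : Set E) (p : E) (α : ⋀[ℝ]^k E) : DiracChain k r U :=
  DiracChain.toSpace.symm (Sections.restrict U (Sections.single p α))

/-- The Banach space of differential `k`-chains of class `B^r` in `U`: the completion of the Dirac
chains in the `B^{r,U}` norm. -/
abbrev DiffChain (k r : ℕ) (U : Set E) : Type _ := Completion (DiracChain k r U)

/-! ### Linking maps and the inductive limit -/

theorem chainSeminorm_anti {k r s : ℕ} {U : Set E} (h : r ≤ s) (A : DiracSpace k U) :
    chainSeminorm k s U A ≤ chainSeminorm k r U A := by
  apply csInf_le_csInf (costSet_bddBelow InsideDiff.cost_nonneg _)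
  · obtain ⟨l, hl⟩ := exists_inside_decomposition r A
    exact ⟨_, l, hl, rfl⟩
  · rintro _ ⟨l, rfl, rfl⟩
    refine ⟨l.map fun d => ⟨d.σ, d.p, d.α, d.order_le.trans h, d.inside⟩, ?_, ?_⟩
    · rw [List.map_map]; rfl
    · rw [List.map_map]; rfl

/-- The identity of Dirac chains, from the `B^{r,U}` norm to the `B^{s,U}` norm, `r ≤ s`. -/
def diracLink {k r s : ℕ} {U : Set E} (h : r ≤ s) : DiracChain k r U →L[ℝ] DiracChain k s U :=
  LinearMap.mkContinuous
    (DiracChain.toSpace.symm.toLinearMap ∘ₗ DiracChain.toSpace.toLinearMap) 1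
    (fun A => by rw [one_mul]; exact chainSeminorm_anti h A.toSpace)

/-- The linking map from chains of class `B^r` to chains of class `B^s`, `r ≤ s`: the continuous
extension of the identity of Dirac chains. -/
def link {k r s : ℕ} {U : Set E} (h : r ≤ s) : DiffChain k r U →L[ℝ] DiffChain k s U :=
  (diracLink h).completion

/-- The inductive limit over `r` of the spaces of differential `k`-chains of class `B^r` in `U`:
differential `k`-chains of class `B^∞`. -/
def LimChain (k : ℕ) (U : Set E) : Type _ :=
  Module.DirectLimit (R := ℝ) (fun r : ℕ => DiffChain k r U)
    (fun _ _ h => (link h).toLinearMap)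

namespace LimChain

variable {k : ℕ} {U : Set E}

instance : AddCommGroup (LimChain k U) :=
  inferInstanceAs (AddCommGroup (Module.DirectLimit (R := ℝ) (fun r : ℕ => DiffChain k r U)
    (fun _ _ h => (link h).toLinearMap)))

instance : Module ℝ (LimChain k U) :=
  inferInstanceAs (Module ℝ (Module.DirectLimit (R := ℝ) (fun r : ℕ => DiffChain k r U)
    (fun _ _ h => (link h).toLinearMap)))

/-- The canonical maps into the inductive limit. -/
def of (r : ℕ) : DiffChain k r U →ₗ[ℝ] LimChain k U :=
  Module.DirectLimit.of ℝ ℕ (fun r : ℕ => DiffChain k r U) (fun _ _ h => (link h).toLinearMap) r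

/-- The inductive limit topology: the finest locally convex vector space topology for which
all canonical maps are continuous. (In Mathlib's order the finer topology is the smaller one.) -/
instance : TopologicalSpace (LimChain k U) :=
  sInf {t | @IsTopologicalAddGroup (LimChain k U) t _ ∧
    @ContinuousSMul ℝ (LimChain k U) _ _ t ∧
    @LocallyConvexSpace ℝ (LimChain k U) _ _ _ _ t ∧
    ∀ r : ℕ, @Continuous (DiffChain k r U) (LimChain k U) _ t (of r)}

end LimChain

/-! ### Differential forms and integration -/

/-- The space of differential `k`-forms of class `B^r` in `U`: the linear functionals `ω` on the
Dirac `k`-chains in `U` for which `|ω (Δ_σ (p; α))| / (‖σ‖ ‖α‖)` is bounded, where `Δ_σ (p; α)` runs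
over the difference chains inside `U` of order at most `r`. -/
def FormSpace (k r : ℕ) (U : Set E) : Submodule ℝ (Module.Dual ℝ (DiracSpace k U)) where
  carrier := {ω | ∃ C : ℝ, ∀ d : InsideDiff k r U, |ω d.chain| ≤ C * d.cost}
  zero_mem' := ⟨0, by simp⟩
  add_mem' := by
    rintro ω η ⟨C, hC⟩ ⟨D, hD⟩
    refine ⟨C + D, fun d => ?_⟩
    rw [LinearMap.add_apply, add_mul]
    exact (abs_add_le _ _).trans (add_le_add (hC d) (hD d))
  smul_mem' := by
    rintro t ω ⟨C, hC⟩
    refine ⟨|t| * C, fun d => ?_⟩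
    rw [LinearMap.smul_apply, smul_eq_mul, abs_mul, mul_assoc]
    exact mul_le_mul_of_nonneg_left (hC d) (abs_nonneg t)

/-- The space of differential `k`-forms of class `B^∞` in `U`. -/
def FormSpaceInf (k : ℕ) (U : Set E) : Submodule ℝ (Module.Dual ℝ (DiracSpace k U)) :=
  ⨅ r : ℕ, FormSpace k r U

theorem exists_bound {k r : ℕ} {U : Set E} {ω : Module.Dual ℝ (DiracSpace k U)}
    (hω : ω ∈ FormSpace k r U) :
    ∃ C : ℝ, ∀ A : DiracChain k r U, ‖(ω ∘ₗ DiracChain.toSpace.toLinearMap) A‖ ≤ C * ‖A‖ := by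
  obtain ⟨C, hC⟩ := hω
  refine ⟨|C|, fun A => ?_⟩
  have hsum : ∀ l : List (InsideDiff k r U),
      |ω (l.map InsideDiff.chain).sum| ≤ |C| * (l.map InsideDiff.cost).sum := by
    intro l
    induction l with
    | nil => simp
    | cons d l ih =>
      simp only [List.map_cons, List.sum_cons, map_add, mul_add]
      refine (abs_add_le _ _).trans (add_le_add ((hC d).trans ?_) ih)
      exact mul_le_mul_of_nonneg_right (le_abs_self C) d.cost_nonneg
  apply le_of_forall_pos_le_add
  intro ε hε
  have hne : (costSet (InsideDiff.chain (r := r)) InsideDiff.cost A.toSpace).Nonempty := by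
    obtain ⟨l, hl⟩ := exists_inside_decomposition r A.toSpace
    exact ⟨_, l, hl, rfl⟩
  obtain ⟨c, ⟨l, hl, rfl⟩, hc⟩ := exists_lt_of_csInf_lt hne
    (lt_add_of_pos_right _ (show 0 < ε / (|C| + 1) by positivity))
  have h4 : |C| * (ε / (|C| + 1)) ≤ ε := by
    rw [mul_div_assoc', div_le_iff₀ (by positivity)]
    nlinarith [abs_nonneg C]
  have h5 := hsum l
  rw [hl] at h5
  have h6 : (l.map InsideDiff.cost).sum ≤ ‖A‖ + ε / (|C| + 1) := hc.le
  calc ‖ω A.toSpace‖ ≤ |C| * (l.map InsideDiff.cost).sum := h5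
    _ ≤ |C| * (‖A‖ + ε / (|C| + 1)) := mul_le_mul_of_nonneg_left h6 (abs_nonneg C)
    _ ≤ |C| * ‖A‖ + ε := by rw [mul_add]; linarith

/-- A form of class `B^r` as a continuous functional on Dirac chains. -/
def evalDirac {k r : ℕ} {U : Set E} (ω : FormSpace k r U) : DiracChain k r U →L[ℝ] ℝ :=
  LinearMap.mkContinuousOfExistsBound (ω.1 ∘ₗ DiracChain.toSpace.toLinearMap) (exists_bound ω.2)

/-- The integral `∫_J ω = lim ω (Aᵢ)`, Dirac chains `Aᵢ → J`, of a form of class `B^r` over a chain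
of class `B^r`. -/
def integral {k r : ℕ} {U : Set E} (ω : FormSpace k r U) : DiffChain k r U →L[ℝ] ℝ :=
  (evalDirac ω).fromCompletion

theorem integral_coe {k r : ℕ} {U : Set E} (ω : FormSpace k r U) (A : DiracChain k r U) :
    integral ω (A : DiffChain k r U) = ω.1 A.toSpace :=
  ContinuousLinearMap.fromCompletion_apply_coe _ _

/-- A form of class `B^∞` as a form of class `B^r`. -/
def formOfInf {k : ℕ} {U : Set E} (ω : FormSpaceInf k U) (r : ℕ) : FormSpace k r U :=
  ⟨ω.1, (Submodule.mem_iInf _).1 ω.2 r⟩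

theorem integral_link {k : ℕ} {U : Set E} (ω : FormSpaceInf k U) {r s : ℕ} (h : r ≤ s)
    (J : DiffChain k r U) :
    integral (formOfInf ω s) (link h J) = integral (formOfInf ω r) J := by
  induction J using Completion.induction_on with
  | hp =>
    exact isClosed_eq ((integral (formOfInf ω s)).continuous.comp (link h).continuous)
      (integral (formOfInf ω r)).continuous
  | ih A =>
    rw [link, ContinuousLinearMap.completion_apply_coe, integral_coe, integral_coe]
    rfl

/-- The integral of a form of class `B^∞` over a chain of class `B^∞`; it agrees with `integral` on
the chains of each class `B^r`. -/
def integralInf {k : ℕ} {U : Set E} (ω : FormSpaceInf k U) : LimChain k U →ₗ[ℝ] ℝ :=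
  Module.DirectLimit.lift ℝ ℕ (fun r : ℕ => DiffChain k r U) (fun _ _ h => (link h).toLinearMap)
    (fun r => (integral (formOfInf ω r)).toLinearMap)
    (fun _ _ h J => integral_link ω h J)

/-! ### Exterior derivative -/

section ExteriorDerivative

variable [FiniteDimensional ℝ E]

theorem continuous_multilinear {k : ℕ} (f : MultilinearMap ℝ (fun _ : Fin k => E) ℝ) :
    Continuous f := by
  induction k with
  | zero => exact continuous_of_const fun x y => by rw [Subsingleton.elim x y]
  | succ k ih =>
    let b := Module.finBasis ℝ E
    have h : ∀ v : Fin (k + 1) → E,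
        f v = ∑ i, b.repr (v 0) i * f.curryLeft (b i) (Fin.tail v) := by
      intro v
      have h1 : f v = f.curryLeft (v 0) (Fin.tail v) := by
        rw [MultilinearMap.curryLeft_apply, Fin.cons_self_tail]
      rw [h1]
      conv_lhs => rw [← b.sum_repr (v 0)]
      simp only [map_sum, map_smul, sum_apply, smul_apply, smul_eq_mul]
    rw [show (f : (Fin (k + 1) → E) → ℝ) = _ from funext h]
    refine continuous_finsetSum _ fun i _ => ?_
    have h2 : Continuous fun x : E => b.repr x i :=
      (b.coord i).continuous_of_finiteDimensional
    refine (h2.comp (continuous_apply 0)).mul ((ih (f.curryLeft (b i))).comp ?_)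
    exact continuous_pi fun j => continuous_apply j.succ

/-- A functional on Dirac chains in `U` as a classical differential form on `U`,
`x ↦ ((v₁, …, vₖ) ↦ ω (x; v₁ ∧ ⋯ ∧ vₖ))` (extended by zero outside of `U`). -/
def toField {k : ℕ} {U : Set E} (ω : Module.Dual ℝ (DiracSpace k U)) (x : E) :
    E [⋀^Fin k]→L[ℝ] ℝ :=
  let f : E [⋀^Fin k]→ₗ[ℝ] ℝ :=
    (ω ∘ₗ Sections.restrict U ∘ₗ Sections.single x).compAlternatingMap
      (exteriorPower.ιMulti ℝ k)
  { f with cont := continuous_multilinear f.toMultilinearMap }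

/-- The exterior derivative: the classical exterior derivative of the field `toField ω`, viewed as
a functional on Dirac `(k+1)`-chains in `U`. -/
def extDer {k : ℕ} {U : Set E} (ω : Module.Dual ℝ (DiracSpace k U)) :
    Module.Dual ℝ (DiracSpace (k + 1) U) :=
  (Finsupp.lsum ℝ fun x : U =>
    exteriorPower.alternatingMapLinearEquiv (extDeriv (toField ω) x).toAlternatingMap) ∘ₗ
      Sections.toFinsupp.toLinearMap

end ExteriorDerivative

/-! ### Boundary -/

/-- Retraction
`E†_v (v₀ ∧ ⋯ ∧ vₖ) = ∑ᵢ (-1)ⁱ ⟪v, vᵢ⟫ v₀ ∧ ⋯ v̂ᵢ ⋯ ∧ vₖ`. -/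
def retraction {k : ℕ} (v : E) : ⋀[ℝ]^(k + 1) E →ₗ[ℝ] ⋀[ℝ]^k E :=
  exteriorPower.alternatingMapLinearEquiv
    (AlternatingMap.alternatizeUncurryFin
      ((innerₛₗ ℝ v).smulRight (exteriorPower.ιMulti ℝ k (M := E))))

/-- The difference quotient `((p + t v; α) - (p; α)) / t`. -/
def diffQuotient {k : ℕ} (r : ℕ) (U : Set E) (v p : E) (α : ⋀[ℝ]^k E) (t : ℝ) :
    DiracChain k r U :=
  t⁻¹ • (element r U (p + t • v) α - element r U p α)

/-- The prederivative `P_v (p; α) = lim_{t → 0} ((p + t v; α) - (p; α)) / t`, a differential chain of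
class `B^r`. -/
def prederivative {k : ℕ} (r : ℕ) (U : Set E) (v p : E) (α : ⋀[ℝ]^k E) : DiffChain k r U :=
  limUnder (𝓝[≠] (0 : ℝ)) fun t => (diffQuotient r U v p α t : DiffChain k r U)

/-- The boundary `∂ = ∑ᵢ P_{eᵢ} E†_{eᵢ}` on Dirac `(k+1)`-chains, with values in the differential
`k`-chains of class `B^{s+1}`; `(eᵢ)` is an orthonormal basis. -/
def boundaryDirac {n k s : ℕ} {U : Set E} (e : OrthonormalBasis (Fin n) ℝ E)
    (A : DiracChain (k + 1) s U) : DiffChain k (s + 1) U :=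
  A.toSpace.toFinsupp.sum fun p α =>
    ∑ i, prederivative (s + 1) U (e i) p (retraction (e i) α)

/-- The boundary of a differential `(k+1)`-chain of class `B^s`: the extension by continuity of the
boundary of Dirac chains. -/
def boundary {n k s : ℕ} {U : Set E} (e : OrthonormalBasis (Fin n) ℝ E)
    (J : DiffChain (k + 1) s U) : DiffChain k (s + 1) U :=
  Completion.extension (boundaryDirac e) J

end DiffChains

end

/-! The norms are infima over decompositions, so a linear map on Dirac chains is bounded as soon as
it is bounded on difference chains inside `U` (`le_atomicSeminorm`).

In class `r ≥ 2` the map `x ↦ (x; α)` has, near a point of `U`, first and second differences bounded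
by `‖u‖ ‖α‖` and `‖u‖ ‖v‖ ‖α‖`. Such bounds make a map into a Banach space differentiable at the
point (`differentiableAt_of_second_difference`). The derivative along `v` is `P_v (p; α)`, which
therefore exists and is linear in `v`.

On a difference chain, `P_v` is the limit of `t⁻¹ Δ_{tv ∘ σ} (p; α)`: the order rises by one and the
cost is multiplied by `‖v‖` (`norm_diracPrederivative_le`). Retraction by a unit vector multiplies
the mass by at most `k + 1` (`mass_retraction_le`), so `∂` is bounded by `n (k + 1)` from class `s`
to class `s + 1`.

A form is a continuous functional on chains, so its value on `P_u (p; α)` is the directional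
derivative of a coefficient. Expansion in the orthonormal basis turns its value on `∂ (p; v₀ ∧ ⋯ ∧
vₖ)` into the alternating sum that defines `dω` (`integral_boundaryₗ`). This is Stokes' theorem on
Dirac chains; the bound for `∂` then bounds `dω`, and density gives the theorem on the completions.
Class `0` and the inductive limit follow from compatibility with the linking maps. -/

noncomputable section

namespace DiffChains

/-! ### Comparison with atomic seminorms -/

section Atomic

variable {ι V : Type*} [AddCommGroup V] [Module ℝ V] {a : ι → V} {w : ι → ℝ}
  {hw : ∀ i, 0 ≤ w i} {hspan : ∀ x : V, ∃ l : List ι, (l.map a).sum = x}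
  {hs : ∀ (t : ℝ) (i : ι), ∃ j, a j = t • a i ∧ w j ≤ |t| * w i}

theorem atomicSeminorm_atom_le (i : ι) : atomicSeminorm a w hw hspan hs (a i) ≤ w i :=
  csInf_le (costSet_bddBelow hw _) ⟨[i], by simp, by simp⟩

/-- A seminorm that is bounded on the atoms is bounded by the atomic seminorm. -/
theorem le_atomicSeminorm (p : Seminorm ℝ V) {C : ℝ} (hC : 0 ≤ C)
    (h : ∀ i, p (a i) ≤ C * w i) (x : V) : p x ≤ C * atomicSeminorm a w hw hspan hs x := by
  have hsum : ∀ l : List ι, p (l.map a).sum ≤ C * (l.map w).sum := by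
    intro l
    induction l with
    | nil => simp
    | cons i l ih =>
      simp only [List.map_cons, List.sum_cons, mul_add]
      exact (map_add_le_add p _ _).trans (add_le_add (h i) ih)
  have hne : (costSet a w x).Nonempty := by
    obtain ⟨l, hl⟩ := hspan x
    exact ⟨_, l, hl, rfl⟩
  change p x ≤ C * sInf (costSet a w x)
  rw [← smul_eq_mul, ← Real.sInf_smul_of_nonneg hC]
  refine le_csInf hne.smul_set ?_
  rintro _ ⟨_, ⟨l, rfl, rfl⟩, rfl⟩
  exact hsum l

end Atomic

/-! ### Maps with bounded second differences -/

section Differentiability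

variable {E X : Type*} [NormedAddCommGroup E] [NormedSpace ℝ E] [NormedAddCommGroup X]
  [NormedSpace ℝ X] [CompleteSpace X]

/-- With `u = v` the hypothesis measures the failure of doubling, so consecutive dyadic rescalings
differ by terms of a geometric series with total at most `M ‖v‖²`. The limit is the candidate for
the derivative along `v`. -/
theorem exists_tendsto_dyadic_of_second_difference {g : E → X} {ε M : ℝ} (hε : 0 < ε)
    (h2 : ∀ u v, ‖u‖ < ε → ‖v‖ < ε → ‖g (u + v) - g u - g v‖ ≤ M * ‖u‖ * ‖v‖) (v : E) :
    ∃ y, Tendsto (fun n : ℕ => (2 : ℝ) ^ n • g (((2 : ℝ) ^ n)⁻¹ • v)) atTop (𝓝 y) ∧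
      (‖v‖ < ε → ‖g v - y‖ ≤ M * ‖v‖ * ‖v‖) := by
  have step : ∀ v : E, ‖v‖ < ε → ∀ n : ℕ,
      dist ((2 : ℝ) ^ n • g (((2 : ℝ) ^ n)⁻¹ • v))
        ((2 : ℝ) ^ (n + 1) • g (((2 : ℝ) ^ (n + 1))⁻¹ • v)) ≤ M * ‖v‖ * ‖v‖ / 2 / 2 ^ n := by
    intro v hv n
    set w := ((2 : ℝ) ^ (n + 1))⁻¹ • v with hw
    have hpow : (1 : ℝ) ≤ 2 ^ (n + 1) := one_le_pow₀ (by norm_num)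
    have hwn : ‖w‖ = ‖v‖ / 2 ^ (n + 1) := by
      rw [hw, norm_smul, norm_inv, norm_pow, Real.norm_ofNat, div_eq_inv_mul]
    have hwε : ‖w‖ < ε := by
      rw [hwn]
      exact (div_le_self (norm_nonneg v) hpow).trans_lt hv
    have hww : ((2 : ℝ) ^ n)⁻¹ • v = w + w := by
      rw [hw, ← add_smul]
      congr 1
      rw [pow_succ]
      field_simp
      norm_num
    have h := h2 w w hwε hwε
    rw [hww, dist_eq_norm]
    have e : (2 : ℝ) ^ n • g (w + w) - (2 : ℝ) ^ (n + 1) • g w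
        = (2 : ℝ) ^ n • (g (w + w) - g w - g w) := by
      rw [pow_succ, mul_smul, two_smul, smul_sub, smul_sub, smul_add]
      abel
    rw [e, norm_smul, norm_pow, Real.norm_ofNat]
    calc (2 : ℝ) ^ n * ‖g (w + w) - g w - g w‖ ≤ 2 ^ n * (M * ‖w‖ * ‖w‖) := by gcongr
      _ = M * ‖v‖ * ‖v‖ / 2 / 2 ^ n / 2 := by
        rw [hwn, pow_succ]
        field_simp
      -- A factor `2` is given away to reach the form `C / 2 / 2 ^ n`. No sign of `M` is assumed;
      -- the nonnegativity used here comes from `h`.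
      _ ≤ M * ‖v‖ * ‖v‖ / 2 / 2 ^ n := by
        have h0 : 0 ≤ M * ‖w‖ * ‖w‖ := (norm_nonneg _).trans h
        have h1 : 0 ≤ M * ‖v‖ * ‖v‖ / 2 / 2 ^ n := by
          have : M * ‖v‖ * ‖v‖ / 2 / 2 ^ n = 2 * 2 ^ n * (M * ‖w‖ * ‖w‖) := by
            rw [hwn, pow_succ]
            field_simp
          rw [this]
          positivity
        linarith
  have small : ∀ v : E, ‖v‖ < ε → ∃ y,
      Tendsto (fun n : ℕ => (2 : ℝ) ^ n • g (((2 : ℝ) ^ n)⁻¹ • v)) atTop (𝓝 y) := fun v hv =>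
    cauchySeq_tendsto_of_complete (cauchySeq_of_le_geometric_two (step v hv))
  -- A long `v` is first shortened to `2⁻ᴺ v`; the sequence of `v`, shifted by `N`, is `2ᴺ` times
  -- the sequence of the short vector.
  obtain ⟨y, hy⟩ : ∃ y,
      Tendsto (fun n : ℕ => (2 : ℝ) ^ n • g (((2 : ℝ) ^ n)⁻¹ • v)) atTop (𝓝 y) := by
    have hlim : Tendsto (fun N : ℕ => ‖((2 : ℝ)⁻¹ ^ N) • v‖) atTop (𝓝 0) := by
      have := ((tendsto_pow_atTop_nhds_zero_of_lt_one (r := (2 : ℝ)⁻¹) (by norm_num)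
        (by norm_num)).smul_const v).norm
      simpa using this
    obtain ⟨N, hN⟩ := (hlim.eventually (gt_mem_nhds hε)).exists
    obtain ⟨y, hy⟩ := small _ hN
    refine ⟨(2 : ℝ) ^ N • y, (tendsto_add_atTop_iff_nat N).1 ?_⟩
    convert hy.const_smul ((2 : ℝ) ^ N) using 2 with n
    rw [smul_smul, smul_smul, inv_pow, pow_add, mul_inv, mul_comm]
  refine ⟨y, hy, fun hv => ?_⟩
  have := dist_le_of_le_geometric_two_of_tendsto₀ (step v hv) hy
  simpa [dist_eq_norm] using this

/-- A map with bounded first and second differences at `x` is differentiable at `x`. -/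
theorem differentiableAt_of_second_difference {f : E → X} {x : E} {ε L M : ℝ} (hε : 0 < ε)
    (h1 : ∀ u, ‖u‖ < ε → ‖f (x + u) - f x‖ ≤ L * ‖u‖)
    (h2 : ∀ u v, ‖u‖ < ε → ‖v‖ < ε →
      ‖f (x + (u + v)) - f (x + u) - f (x + v) + f x‖ ≤ M * ‖u‖ * ‖v‖) :
    DifferentiableAt ℝ f x := by
  set g : E → X := fun u => f (x + u) - f x with hg
  have h2' : ∀ u v, ‖u‖ < ε → ‖v‖ < ε → ‖g (u + v) - g u - g v‖ ≤ M * ‖u‖ * ‖v‖ := by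
    intro u v hu hv
    convert h2 u v hu hv using 2
    simp only [hg]
    abel
  choose T hT hTg using exists_tendsto_dyadic_of_second_difference hε h2'
  have hsmall : ∀ v : E, Tendsto (fun n : ℕ => ‖((2 : ℝ) ^ n)⁻¹ • v‖) atTop (𝓝 0) := fun v => by
    have := ((tendsto_pow_atTop_nhds_zero_of_lt_one (r := (2 : ℝ)⁻¹) (by norm_num)
      (by norm_num)).smul_const v).norm
    simpa only [inv_pow, zero_smul, norm_zero] using this
  have hpow : Tendsto (fun n : ℕ => ((2 : ℝ) ^ n)⁻¹) atTop (𝓝 0) := by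
    simpa only [inv_pow] using tendsto_pow_atTop_nhds_zero_of_lt_one (r := (2 : ℝ)⁻¹)
      (by norm_num) (by norm_num)
  -- At scale `2⁻ⁿ` the defect of additivity is at most `2ⁿ · 4⁻ⁿ M ‖u‖ ‖v‖`, which tends to zero.
  have hadd : ∀ u v, T (u + v) = T u + T v := by
    intro u v
    have hlim : Tendsto (fun n : ℕ => (2 : ℝ) ^ n • g (((2 : ℝ) ^ n)⁻¹ • (u + v))
        - (2 : ℝ) ^ n • g (((2 : ℝ) ^ n)⁻¹ • u) - (2 : ℝ) ^ n • g (((2 : ℝ) ^ n)⁻¹ • v))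
        atTop (𝓝 0) := by
      refine squeeze_zero_norm' (a := fun n : ℕ => ((2 : ℝ) ^ n)⁻¹ * (M * ‖u‖ * ‖v‖)) ?_
        (by simpa using hpow.mul_const (M * ‖u‖ * ‖v‖))
      filter_upwards [(hsmall u).eventually (gt_mem_nhds hε),
        (hsmall v).eventually (gt_mem_nhds hε)] with n hu hv
      rw [← smul_sub, ← smul_sub, norm_smul, norm_pow, Real.norm_ofNat, smul_add]
      refine (mul_le_mul_of_nonneg_left (h2' _ _ hu hv) (by positivity)).trans (le_of_eq ?_)
      simp only [norm_smul, norm_inv, norm_pow, Real.norm_ofNat]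
      field_simp
    have := tendsto_nhds_unique hlim (((hT (u + v)).sub (hT u)).sub (hT v))
    rw [sub_sub, eq_comm, sub_eq_zero] at this
    exact this
  have hbound : ∀ v, ‖T v‖ ≤ L * ‖v‖ := by
    intro v
    refine le_of_tendsto (hT v).norm ?_
    filter_upwards [(hsmall v).eventually (gt_mem_nhds hε)] with n hv
    rw [norm_smul, norm_pow, Real.norm_ofNat]
    refine (mul_le_mul_of_nonneg_left (h1 _ hv) (by positivity)).trans (le_of_eq ?_)
    simp only [norm_smul, norm_inv, norm_pow, Real.norm_ofNat]
    field_simp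
  -- A continuous additive map is real linear, so homogeneity needs no separate argument.
  let A : E →+ X := AddMonoidHom.mk' T hadd
  have hA : Continuous A := AddMonoidHomClass.continuous_of_bound A L hbound
  refine ⟨A.toRealLinearMap hA, ?_⟩
  rw [hasFDerivAt_iff_isLittleO_nhds_zero]
  refine Asymptotics.IsBigO.trans_isLittleO (g := fun h : E => ‖h‖ ^ 2) ?_ ?_
  · refine Asymptotics.IsBigO.of_bound M ?_
    filter_upwards [Metric.ball_mem_nhds (0 : E) hε] with v hv
    have := hTg v (by simpa using hv)
    rw [norm_pow, norm_norm, pow_two, ← mul_assoc]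
    exact this
  · exact Asymptotics.isLittleO_norm_pow_id one_lt_two

end Differentiability

variable {E : Type*} [NormedAddCommGroup E] [InnerProductSpace ℝ E]

/-! ### Mass of simple vectors and of retractions -/

theorem mass_smul_ιMulti_le {k : ℕ} (c : ℝ) (v : Fin k → E) :
    mass k (c • exteriorPower.ιMulti ℝ k v) ≤
      |c| * √(Matrix.det (Matrix.of fun i j => ⟪v i, v j⟫)) :=
  atomicSeminorm_atom_le (a := fun x : ℝ × (Fin k → E) => x.1 • exteriorPower.ιMulti ℝ k x.2)
    (c, v)

theorem mass_ιMulti_le_one {k : ℕ} {f : Fin k → E} (hf : Orthonormal ℝ f) :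
    mass k (exteriorPower.ιMulti ℝ k f) ≤ 1 := by
  have h := mass_smul_ιMulti_le 1 f
  have h1 : (Matrix.of fun i j => ⟪f i, f j⟫) = 1 := by
    ext i j
    rw [Matrix.of_apply, Matrix.one_apply]
    exact orthonormal_iff_ite.1 hf i j
  rwa [h1, Matrix.det_one, Real.sqrt_one, one_smul, abs_one, mul_one] at h

/-- A nondegenerate simple vector is a multiple of a unit simple vector, with factor the square
root of the Gram determinant. -/
theorem exists_orthonormal_ιMulti {k : ℕ} {v : Fin k → E} (hv : LinearIndependent ℝ v) :
    ∃ f : Fin k → E, Orthonormal ℝ f ∧ ∃ c : ℝ,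
      exteriorPower.ιMulti ℝ k v = c • exteriorPower.ιMulti ℝ k f ∧
      |c| = √(Matrix.det (Matrix.of fun i j => ⟪v i, v j⟫)) := by
  classical
  let W := Submodule.span ℝ (Set.range v)
  have hW : Module.finrank ℝ W = k := by
    rw [finrank_span_eq_card hv, Fintype.card_fin]
  have : FiniteDimensional ℝ W := FiniteDimensional.span_of_finite ℝ (Set.finite_range v)
  let b : OrthonormalBasis (Fin k) ℝ W := (stdOrthonormalBasis ℝ W).reindex (finCongr hW)
  let v' : Fin k → W := fun i => ⟨v i, Submodule.subset_span ⟨i, rfl⟩⟩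
  let g := (exteriorPower.ιMulti ℝ k (M := E)).compLinearMap W.subtype
  -- An alternating `k`-linear map on the `k`-dimensional space `W` is its value on a basis times
  -- the determinant in that basis.
  have hg : g = (LinearMap.toSpanSingleton ℝ _ (g b)).compAlternatingMap b.toBasis.det := by
    refine Module.Basis.ext_alternating b.toBasis fun i h => ?_
    let σ : Equiv.Perm (Fin k) := Equiv.ofBijective i (Finite.injective_iff_bijective.1 h)
    change g (b.toBasis ∘ σ) = LinearMap.toSpanSingleton ℝ _ (g b) (b.toBasis.det (b.toBasis ∘ σ))
    have hb : b.toBasis.det b = 1 := by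
      have := b.toBasis.det_self
      rwa [b.coe_toBasis] at this
    simp [AlternatingMap.map_perm, hb]
  refine ⟨fun i => b i, b.orthonormal.comp_linearIsometry W.subtypeₗᵢ, b.toBasis.det v', ?_, ?_⟩
  · exact congrArg (fun F => F v') hg
  -- The Gram matrix is `MᵀM`, with `M` the matrix of `v'` in the orthonormal basis, and the factor
  -- `c` is `det M`.
  · have hG : (Matrix.of fun i j => ⟪v i, v j⟫) =
        (b.toBasis.toMatrix v').transpose * b.toBasis.toMatrix v' := by
      ext i j
      rw [Matrix.of_apply, Matrix.mul_apply]
      change ⟪v' i, v' j⟫ = _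
      rw [← b.sum_inner_mul_inner]
      refine Finset.sum_congr rfl fun l _ => ?_
      simp only [Matrix.transpose_apply, Module.Basis.toMatrix_apply,
        OrthonormalBasis.coe_toBasis_repr_apply, OrthonormalBasis.repr_apply_apply]
      rw [real_inner_comm]
    rw [hG, Matrix.det_mul, Matrix.det_transpose, Real.sqrt_mul_self_eq_abs, Module.Basis.det_apply]

theorem retraction_ιMulti {k : ℕ} (u : E) (v : Fin (k + 1) → E) :
    retraction u (exteriorPower.ιMulti ℝ (k + 1) v) =
      ∑ i : Fin (k + 1), (-1 : ℝ) ^ (i : ℕ) • ⟪u, v i⟫ •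
        exteriorPower.ιMulti ℝ k (i.removeNth v) := by
  rw [retraction, exteriorPower.alternatingMapLinearEquiv_apply_ιMulti,
    AlternatingMap.alternatizeUncurryFin_apply]
  refine Finset.sum_congr rfl fun i _ => ?_
  rw [← Int.cast_smul_eq_zsmul ℝ]
  simp

/-- For a general frame the `k + 1` terms of the retraction need not be controlled by the Gram
determinant. A nondegenerate simple vector is therefore rewritten with an orthonormal frame, where
each term has mass at most `‖u‖`; a degenerate one is zero. -/
theorem mass_retraction_le {k : ℕ} (u : E) (β : ⋀[ℝ]^(k + 1) E) :
    mass k (retraction u β) ≤ (k + 1) * ‖u‖ * mass (k + 1) β := by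
  refine le_atomicSeminorm ((mass k).comp (retraction u)) (by positivity) ?_ β
  rintro ⟨c, v⟩
  simp only [Seminorm.comp_apply, map_smul_eq_mul, Real.norm_eq_abs]
  by_cases hv : LinearIndependent ℝ v
  · obtain ⟨f, hf, d, hd, hd'⟩ := exists_orthonormal_ιMulti hv
    have hf1 : mass k (retraction u (exteriorPower.ιMulti ℝ (k + 1) f)) ≤ (k + 1) * ‖u‖ := by
      rw [retraction_ιMulti]
      refine (Finset.le_sum_of_subadditive (mass k) (map_zero _).le (map_add_le_add _) _ _).trans ?_
      have : ∀ i ∈ (Finset.univ : Finset (Fin (k + 1))), mass k ((-1 : ℝ) ^ (i : ℕ) • ⟪u, f i⟫ •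
          exteriorPower.ιMulti ℝ k (i.removeNth f)) ≤ ‖u‖ := by
        intro i _
        rw [map_smul_eq_mul, map_smul_eq_mul, norm_pow, norm_neg, norm_one, one_pow, one_mul]
        have h1 : ‖⟪u, f i⟫‖ ≤ ‖u‖ := by
          simpa [hf.1 i] using norm_inner_le_norm (𝕜 := ℝ) u (f i)
        have h2 := mass_ιMulti_le_one (hf.comp _ i.succAbove_right_injective)
        exact (mul_le_mul h1 h2 (apply_nonneg _ _) (norm_nonneg u)).trans_eq (mul_one _)
      refine (Finset.sum_le_card_nsmul _ _ _ this).trans ?_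
      simp
    rw [hd, map_smul, map_smul_eq_mul, Real.norm_eq_abs, ← hd']
    nlinarith [mul_le_mul_of_nonneg_left hf1 (mul_nonneg (abs_nonneg c) (abs_nonneg d))]
  · rw [AlternatingMap.map_linearDependent _ _ hv, map_zero, map_zero, mul_zero]
    positivity

variable {k r : ℕ} {U : Set E}

/-! ### Dirac chains as elements of the completed spaces -/

theorem support_single_subset (p : E) (α : ⋀[ℝ]^k E) :
    (Sections.single p α).support ⊆ {p} := by
  rw [← Finset.coe_singleton]
  exact Finset.coe_subset.2 Finsupp.support_single_subset

theorem translate_single (u p : E) (α : ⋀[ℝ]^k E) :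
    translate u (Sections.single p α) = Sections.single (p + u) α :=
  Finsupp.mapDomain_single

theorem support_sub_subset (A B : Sections k E E) :
    (A - B).support ⊆ A.support ∪ B.support := by
  classical
  rw [Sections.support, Sections.support, Sections.support, ← Finset.coe_union]
  exact Finset.coe_subset.2 Finsupp.support_sub

theorem support_translate_subset (u : E) (A : Sections k E E) :
    (translate u A).support ⊆ (fun p => p + u) '' A.support := by
  classical
  rw [Sections.support, Sections.support, ← Finset.coe_image]
  exact Finset.coe_subset.2 Finsupp.mapDomain_support

/-- The chain in the completed space `DiffChain k r U` given by the restriction to `U` of a Dirac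
chain in the ambient space. -/
def toDiffChain (k r : ℕ) (U : Set E) : Sections k E E →ₗ[ℝ] DiffChain k r U :=
  (Completion.toComplL (𝕜 := ℝ) (E := DiracChain k r U)).toLinearMap ∘ₗ
    DiracChain.toSpace.symm.toLinearMap ∘ₗ Sections.restrict U

theorem toDiffChain_single (p : E) (α : ⋀[ℝ]^k E) :
    toDiffChain k r U (Sections.single p α) = (element r U p α : DiffChain k r U) := rfl

theorem norm_chain_le (d : InsideDiff k r U) :
    ‖(DiracChain.toSpace.symm d.chain : DiracChain k r U)‖ ≤ d.cost :=
  csInf_le (costSet_bddBelow InsideDiff.cost_nonneg _) ⟨[d], by simp, by simp⟩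

theorem norm_toDiffChain_le {σ : List E} {p : E} {α : ⋀[ℝ]^k E} (hσ : σ.length ≤ r)
    (h : convexHull ℝ (diffChain σ p α).support ⊆ U) :
    ‖toDiffChain k r U (diffChain σ p α)‖ ≤ (σ.map norm).prod * mass k α :=
  (Completion.norm_coe _).trans_le (norm_chain_le ⟨σ, p, α, hσ, h⟩)

/-! ### Existence and linearity of prederivatives -/

/-- A ball around `p` in `U` is convex, so short difference chains of orders one and two at `p` are
inside `U`, and their costs are the required bounds on differences. Second differences are
admissible because `r ≥ 2`. -/
theorem differentiableAt_element (hr : 2 ≤ r) (hU : IsOpen U) {p : E} (hp : p ∈ U)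
    (α : ⋀[ℝ]^k E) :
    DifferentiableAt ℝ (fun x => (element r U x α : DiffChain k r U)) p := by
  obtain ⟨ε, hε, hball⟩ := Metric.isOpen_iff.1 hU p hp
  have hmem : ∀ {u : E}, ‖u‖ < ε → p + u ∈ Metric.ball p ε := fun hu => by simpa using hu
  have hhull : ∀ {S : Set E}, S ⊆ Metric.ball p ε → convexHull ℝ S ⊆ U := fun hS =>
    (convexHull_min hS (convex_ball p ε)).trans hball
  have hsupp1 : ∀ q u : E, (diffChain [u] q α).support ⊆ {q + u, q} := by
    intro q u
    rw [diffChain, diffChain, translate_single]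
    exact (support_sub_subset _ _).trans
      (Set.union_subset_union (support_single_subset _ _) (support_single_subset _ _))
  -- Half the radius keeps the corner `p + u + v` in the ball.
  refine differentiableAt_of_second_difference (ε := ε / 2) (L := mass k α) (M := mass k α)
    (half_pos hε) ?_ ?_
  · intro u hu
    have h := norm_toDiffChain_le (r := r) (U := U) (σ := [u]) (p := p) (α := α)
      (by simp only [List.length_singleton]; lia) (hhull ((hsupp1 p u).trans ?_))
    · simpa [diffChain, translate_single, toDiffChain_single, mul_comm] using h
    · rintro x (rfl | rfl)
      · exact hmem (hu.trans (half_lt_self hε))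
      · exact Metric.mem_ball_self hε
  · intro u v hu hv
    have h := norm_toDiffChain_le (r := r) (U := U) (σ := [u, v]) (p := p) (α := α)
      (by simpa using hr) (hhull ?_)
    · simp only [diffChain, map_sub, translate_single, toDiffChain_single, List.map_cons,
        List.map_nil, List.prod_cons, List.prod_nil, mul_one] at h
      convert h using 1
      · congr 1
        rw [add_right_comm, add_assoc]
        abel
      · ring
    · rw [diffChain]
      refine (support_sub_subset _ _).trans (Set.union_subset
        ((support_translate_subset _ _).trans ?_) ((hsupp1 p v).trans ?_))
      · rintro _ ⟨x, hx, rfl⟩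
        rcases hsupp1 p v hx with rfl | rfl
        · change p + v + u ∈ _
          rw [add_assoc]
          exact hmem ((norm_add_le v u).trans_lt (by linarith))
        · exact hmem (hu.trans (half_lt_self hε))
      · rintro x (rfl | rfl)
        · exact hmem (hv.trans (half_lt_self hε))
        · exact Metric.mem_ball_self hε

theorem tendsto_diffQuotient_fderiv (hr : 2 ≤ r) (hU : IsOpen U) {p : E} (hp : p ∈ U) (v : E)
    (α : ⋀[ℝ]^k E) :
    Tendsto (fun t : ℝ => (diffQuotient r U v p α t : DiffChain k r U)) (𝓝[≠] 0)
      (𝓝 (fderiv ℝ (fun x => (element r U x α : DiffChain k r U)) p v)) := by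
  have h := ((differentiableAt_element hr hU hp α).hasFDerivAt.hasLineDerivAt v).tendsto_slope_zero
  refine h.congr fun t => ?_
  rw [diffQuotient, Completion.coe_smul, Completion.coe_sub]

/-- `limUnder` carries information only when the limit exists; differentiability ensures this, and
uniqueness of limits identifies the value. -/
theorem prederivative_eq_fderiv (hr : 2 ≤ r) (hU : IsOpen U) {p : E} (hp : p ∈ U) (v : E)
    (α : ⋀[ℝ]^k E) :
    prederivative r U v p α = fderiv ℝ (fun x => (element r U x α : DiffChain k r U)) p v :=
  (tendsto_diffQuotient_fderiv hr hU hp v α).limUnder_eq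

theorem tendsto_diffQuotient (hr : 2 ≤ r) (hU : IsOpen U) {p : E} (hp : p ∈ U) (v : E)
    (α : ⋀[ℝ]^k E) :
    Tendsto (fun t : ℝ => (diffQuotient r U v p α t : DiffChain k r U)) (𝓝[≠] 0)
      (𝓝 (prederivative r U v p α)) := by
  rw [prederivative_eq_fderiv hr hU hp]
  exact tendsto_diffQuotient_fderiv hr hU hp v α

theorem coe_diffQuotient (v p : E) (α : ⋀[ℝ]^k E) (t : ℝ) :
    (diffQuotient r U v p α t : DiffChain k r U) =
      t⁻¹ • (toDiffChain k r U (translate (t • v) (Sections.single p α)) -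
        toDiffChain k r U (Sections.single p α)) := by
  rw [diffQuotient, Completion.coe_smul, Completion.coe_sub, translate_single,
    toDiffChain_single, toDiffChain_single]

/-- The prederivative at a point of `U`, as a linear map on `k`-vectors. -/
def prederivativeₗ (hr : 2 ≤ r) (hU : IsOpen U) (v : E) (p : U) :
    ⋀[ℝ]^k E →ₗ[ℝ] DiffChain k r U where
  toFun α := prederivative r U v p α
  map_add' α β := by
    refine tendsto_nhds_unique (tendsto_diffQuotient hr hU p.2 v (α + β)) ?_
    refine ((tendsto_diffQuotient hr hU p.2 v α).add
      (tendsto_diffQuotient hr hU p.2 v β)).congr fun t => ?_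
    simp only [coe_diffQuotient, map_add, ← smul_add]
    congr 1
    abel
  map_smul' c α := by
    refine tendsto_nhds_unique (tendsto_diffQuotient hr hU p.2 v (c • α)) ?_
    refine ((tendsto_diffQuotient hr hU p.2 v α).const_smul c).congr fun t => ?_
    simp only [coe_diffQuotient, map_smul, ← smul_sub]
    rw [smul_comm]

/-- The prederivative of Dirac chains in `U`. -/
def diracPrederivative (hr : 2 ≤ r) (hU : IsOpen U) (v : E) :
    DiracSpace k U →ₗ[ℝ] DiffChain k r U :=
  (Finsupp.lsum ℝ fun p : U => prederivativeₗ hr hU v p) ∘ₗ Sections.toFinsupp.toLinearMap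

theorem diracPrederivative_single (hr : 2 ≤ r) (hU : IsOpen U) (v : E) (p : U) (α : ⋀[ℝ]^k E) :
    diracPrederivative hr hU v (Sections.single p α) = prederivative r U v p α :=
  Finsupp.lsum_single ℝ _ p α

theorem sections_induction {X : Type*} {C : Sections k E X → Prop} (A : Sections k E X)
    (zero : C 0) (add : ∀ A B, C A → C B → C (A + B)) (single : ∀ p α, C (Sections.single p α)) :
    C A :=
  Finsupp.induction_linear A zero add single

theorem restrict_single_of_mem {p : E} (hp : p ∈ U) (α : ⋀[ℝ]^k E) :
    Sections.restrict U (Sections.single p α) = Sections.single (⟨p, hp⟩ : U) α := by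
  classical
  refine Finsupp.ext fun q => ?_
  change Finsupp.single p α (q : E) = Finsupp.single (⟨p, hp⟩ : U) α q
  simp [Finsupp.single_apply, Subtype.ext_iff]

/-- Induction over such a list keeps every base point in `U`, which plain induction on ambient Dirac
chains does not. -/
theorem exists_restrict_eq {A : Sections k E E} (hA : A.support ⊆ U) :
    ∃ l : List (U × ⋀[ℝ]^k E), A = (l.map fun x => Sections.single (x.1 : E) x.2).sum := by
  classical
  refine ⟨A.toFinsupp.support.attach.toList.map
    fun p : A.toFinsupp.support => (⟨p, hA p.2⟩, A.toFinsupp p), ?_⟩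
  rw [List.map_map, Finset.sum_map_toList]
  exact (Finsupp.sum_single A.toFinsupp).symm.trans
    (Finset.sum_attach A.toFinsupp.support
      fun p => (Finsupp.single p (A.toFinsupp p) : Sections k E E)).symm

/-- Translation takes place in the ambient space and restriction to `U` comes afterwards, because a
translate may leave `U` when `t` is not small. -/
theorem tendsto_diracPrederivative (hr : 2 ≤ r) (hU : IsOpen U) (v : E) {A : Sections k E E}
    (hA : A.support ⊆ U) :
    Tendsto (fun t : ℝ => t⁻¹ • (toDiffChain k r U (translate (t • v) A) - toDiffChain k r U A))
      (𝓝[≠] 0) (𝓝 (diracPrederivative hr hU v (Sections.restrict U A))) := by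
  obtain ⟨l, rfl⟩ := exists_restrict_eq hA
  clear hA
  induction l with
  | nil => simp
  | cons x l ih =>
    simp only [List.map_cons, List.sum_cons, map_add]
    rw [restrict_single_of_mem x.1.2, diracPrederivative_single]
    refine ((tendsto_diffQuotient hr hU x.1.2 v x.2).add ih).congr fun t => ?_
    rw [coe_diffQuotient, ← smul_add]
    congr 1
    abel

/-- The quotient `t⁻¹ (T_{tv} - I) Δ_σ` is `t⁻¹ Δ_{tv ∘ σ}`, an admissible chain of order at most `r
+ 1`. The factor `|t|` in its cost cancels `t⁻¹`, so the bound survives the limit. -/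
theorem norm_diracPrederivative_le (hU : IsOpen U) (hr : 2 ≤ r + 1) (v : E) {σ : List E} {p : E}
    {α : ⋀[ℝ]^k E} (hσ : σ.length ≤ r) (h : convexHull ℝ (diffChain σ p α).support ⊆ U) :
    ‖diracPrederivative hr hU v (Sections.restrict U (diffChain σ p α))‖ ≤
      ‖v‖ * ((σ.map norm).prod * mass k α) := by
  set A := diffChain σ p α with hA
  refine le_of_tendsto
    (tendsto_diracPrederivative hr hU v ((subset_convexHull ℝ _).trans h)).norm ?_
  -- The hull of a finite support is compact, so some thickening of it lies in `U`. The thickening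
  -- is convex and contains the translated support once `‖t v‖ < ε`.
  have hfin : A.support.Finite := A.toFinsupp.support.finite_toSet
  obtain ⟨ε, hε, hthick⟩ := (hfin.isCompact_convexHull ℝ).exists_thickening_subset_open hU h
  have hsmall : ∀ᶠ t : ℝ in 𝓝[≠] 0, ‖t • v‖ < ε := by
    have hc : ContinuousAt (fun t : ℝ => ‖t • v‖) 0 := by fun_prop
    exact nhdsWithin_le_nhds (hc.eventually (gt_mem_nhds (by simpa using hε)))
  filter_upwards [hsmall, self_mem_nhdsWithin] with t ht ht0
  have hsub : A.support ⊆ Metric.thickening ε (convexHull ℝ A.support) :=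
    (subset_convexHull ℝ _).trans (Metric.self_subset_thickening hε _)
  have hd := norm_toDiffChain_le (r := r + 1) (U := U) (σ := (t • v) :: σ) (p := p) (α := α)
    (by simpa using hσ) ?_
  · rw [← map_sub, norm_smul, norm_inv]
    rw [diffChain, List.map_cons, List.prod_cons, norm_smul] at hd
    have ht' : 0 < ‖t‖ := norm_pos_iff.2 ht0
    rw [inv_mul_le_iff₀ ht']
    exact hd.trans_eq (by ring)
  · refine (convexHull_min ?_ ((convex_convexHull ℝ A.support).thickening ε)).trans hthick
    rw [diffChain]
    refine (support_sub_subset _ _).trans (Set.union_subset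
      ((support_translate_subset _ _).trans ?_) hsub)
    rintro _ ⟨x, hx, rfl⟩
    exact Metric.mem_thickening_iff.2 ⟨x, subset_convexHull ℝ _ hx, by simpa [dist_eq_norm] using ht⟩

/-! ### Linear maps of `k`-vectors acting on Dirac chains -/

/-- The pointwise action of a linear map of multivectors on Dirac chains. -/
def mapSections {l : ℕ} (X : Type*) (f : ⋀[ℝ]^k E →ₗ[ℝ] ⋀[ℝ]^l E) :
    Sections k E X →ₗ[ℝ] Sections l E X :=
  Sections.toFinsupp.symm.toLinearMap ∘ₗ Finsupp.mapRange.linearMap f ∘ₗ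
    Sections.toFinsupp.toLinearMap

variable {l : ℕ} (f : ⋀[ℝ]^k E →ₗ[ℝ] ⋀[ℝ]^l E)

theorem mapSections_single {X : Type*} (p : X) (α : ⋀[ℝ]^k E) :
    mapSections X f (Sections.single p α) = Sections.single p (f α) :=
  Finsupp.mapRange_single (hf := map_zero f)

theorem mapSections_restrict (A : Sections k E E) :
    mapSections U f (Sections.restrict U A) = Sections.restrict U (mapSections E f A) :=
  Finsupp.ext fun _ => rfl

theorem mapSections_translate (u : E) (A : Sections k E E) :
    mapSections E f (translate u A) = translate u (mapSections E f A) := by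
  induction A using sections_induction with
  | zero => simp
  | add A B hA hB => simp only [map_add, hA, hB]
  | single p α => simp only [translate_single, mapSections_single]

theorem mapSections_diffChain (σ : List E) (p : E) (α : ⋀[ℝ]^k E) :
    mapSections E f (diffChain σ p α) = diffChain σ p (f α) := by
  induction σ with
  | nil => exact mapSections_single f p α
  | cons u σ ih => rw [diffChain, diffChain, map_sub, mapSections_translate, ih]

/-- This keeps a difference chain inside `U` when its multivector is retracted: a linear map acting
pointwise cannot enlarge the support. -/
theorem support_diffChain_map_subset (σ : List E) (p : E) (α : ⋀[ℝ]^k E) :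
    (diffChain σ p (f α)).support ⊆ (diffChain σ p α).support := by
  rw [← mapSections_diffChain]
  exact Finset.coe_subset.2 (Finsupp.support_mapRange (hf := map_zero f))

/-! ### The boundary operator -/

section Boundary

variable {n s : ℕ} (e : OrthonormalBasis (Fin n) ℝ E)

/-- The boundary of Dirac chains as a linear map. -/
def boundaryₗ (hU : IsOpen U) (hs : 2 ≤ s + 1) :
    DiracChain (k + 1) s U →ₗ[ℝ] DiffChain k (s + 1) U :=
  (∑ i, diracPrederivative hs hU (e i) ∘ₗ mapSections U (retraction (e i))) ∘ₗ
    DiracChain.toSpace.toLinearMap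

theorem boundaryₗ_apply (hU : IsOpen U) (hs : 2 ≤ s + 1) (A : DiracChain (k + 1) s U) :
    boundaryₗ e hU hs A =
      ∑ i, diracPrederivative hs hU (e i) (mapSections U (retraction (e i)) A.toSpace) := by
  simp [boundaryₗ]

theorem boundaryₗ_single (hU : IsOpen U) (hs : 2 ≤ s + 1) (p : U) (β : ⋀[ℝ]^(k + 1) E) :
    boundaryₗ e hU hs (DiracChain.toSpace.symm (Sections.single p β)) =
      ∑ i, prederivative (s + 1) U (e i) p (retraction (e i) β) := by
  rw [boundaryₗ_apply]
  refine Finset.sum_congr rfl fun i _ => ?_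
  rw [LinearEquiv.apply_symm_apply, mapSections_single, diracPrederivative_single]

/-- The sum over the support is linear in the chain because each prederivative at a point of `U` is
linear in the multivector; comparison on single elements then suffices. -/
theorem boundaryDirac_eq (hU : IsOpen U) (hs : 2 ≤ s + 1) (A : DiracChain (k + 1) s U) :
    boundaryDirac e A = boundaryₗ e hU hs A := by
  let F : DiracChain (k + 1) s U →ₗ[ℝ] DiffChain k (s + 1) U :=
    (Finsupp.lsum ℝ fun p : U => ∑ i, prederivativeₗ hs hU (e i) p ∘ₗ retraction (e i)) ∘ₗ
      Sections.toFinsupp.toLinearMap ∘ₗ DiracChain.toSpace.toLinearMap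
  have hF : boundaryDirac e A = F A := by
    change _ = A.toSpace.toFinsupp.sum _
    refine Finsupp.sum_congr fun p _ => ?_
    simp [prederivativeₗ]
  rw [hF]
  refine LinearMap.congr_fun (f := F) (Finsupp.lhom_ext fun p β => ?_) A
  refine Eq.trans ?_ (boundaryₗ_single e hU hs p β).symm
  refine (Finsupp.lsum_single ℝ _ p β).trans ?_
  simp [prederivativeₗ]

/-- Each of the `n` basis directions contributes a factor `k + 1` from the retraction and `‖e i‖ =
1` from the prederivative. -/
theorem norm_boundaryₗ_chain_le (hU : IsOpen U) (hs : 2 ≤ s + 1) (d : InsideDiff (k + 1) s U) :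
    ‖boundaryₗ e hU hs (DiracChain.toSpace.symm d.chain)‖ ≤ n * (k + 1) * d.cost := by
  rw [boundaryₗ_apply, LinearEquiv.apply_symm_apply]
  have h : ∀ i ∈ (Finset.univ : Finset (Fin n)),
      ‖diracPrederivative hs hU (e i) (mapSections U (retraction (e i)) d.chain)‖ ≤
        (k + 1) * d.cost := by
    intro i _
    rw [InsideDiff.chain, mapSections_restrict, mapSections_diffChain]
    refine (norm_diracPrederivative_le hU hs (e i) d.order_le
      ((convexHull_mono (support_diffChain_map_subset _ _ _ _)).trans d.inside)).trans ?_
    have h1 := mass_retraction_le (e i) d.α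
    rw [e.orthonormal.1 i, mul_one] at h1
    have h0 : 0 ≤ (d.σ.map norm).prod := List.prod_nonneg fun y hy => by
      obtain ⟨u, -, rfl⟩ := List.mem_map.1 hy
      exact norm_nonneg u
    rw [e.orthonormal.1 i, one_mul, InsideDiff.cost]
    exact (mul_le_mul_of_nonneg_left h1 h0).trans_eq (by ring)
  refine (norm_sum_le_of_le _ h).trans_eq ?_
  simp [mul_assoc]

theorem norm_boundaryₗ_le (hU : IsOpen U) (hs : 2 ≤ s + 1) (A : DiracChain (k + 1) s U) :
    ‖boundaryₗ e hU hs A‖ ≤ n * (k + 1) * ‖A‖ := by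
  rw [DiracChain.norm_def, chainSeminorm]
  exact le_atomicSeminorm ((normSeminorm ℝ (DiffChain k (s + 1) U)).comp
    (boundaryₗ e hU hs ∘ₗ DiracChain.toSpace.symm.toLinearMap)) (by positivity)
    (norm_boundaryₗ_chain_le e hU hs) A.toSpace

/-- The boundary as a continuous linear operator. -/
def boundaryL (hU : IsOpen U) (hs : 2 ≤ s + 1) :
    DiffChain (k + 1) s U →L[ℝ] DiffChain k (s + 1) U :=
  ((boundaryₗ e hU hs).mkContinuous (n * (k + 1)) (norm_boundaryₗ_le e hU hs)).fromCompletion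

theorem boundaryL_apply (hU : IsOpen U) (hs : 2 ≤ s + 1) (J : DiffChain (k + 1) s U) :
    boundaryL e hU hs J = boundary e J := by
  rw [boundary, funext (boundaryDirac_eq e hU hs), boundaryL,
    ContinuousLinearMap.coe_fromCompletion]
  rfl

theorem boundaryL_coe (hU : IsOpen U) (hs : 2 ≤ s + 1) (A : DiracChain (k + 1) s U) :
    boundaryL e hU hs (A : DiffChain (k + 1) s U) = boundaryₗ e hU hs A :=
  ContinuousLinearMap.fromCompletion_apply_coe _ _

theorem link_prederivative {q : ℕ} (hr : 2 ≤ r) (hrq : r ≤ q) (hU : IsOpen U) (v : E) {p : E}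
    (hp : p ∈ U) (α : ⋀[ℝ]^k E) :
    link hrq (prederivative r U v p α) = prederivative q U v p α := by
  refine tendsto_nhds_unique (((link hrq).continuous.tendsto _).comp
    (tendsto_diffQuotient hr hU hp v α)) ?_
  refine (tendsto_diffQuotient (hr.trans hrq) hU hp v α).congr fun t => ?_
  rw [Function.comp_apply, link, ContinuousLinearMap.completion_apply_coe]
  rfl

theorem link_boundaryL {t : ℕ} (hU : IsOpen U) (hs : 2 ≤ s + 1) (hst : s ≤ t)
    (J : DiffChain (k + 1) s U) :
    link (Nat.succ_le_succ hst) (boundaryL e hU hs J) =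
      boundaryL e hU (hs.trans (Nat.succ_le_succ hst)) (link hst J) := by
  induction J using Completion.induction_on with
  | hp =>
    exact isClosed_eq ((link _).continuous.comp (boundaryL e hU hs).continuous)
      ((boundaryL e hU _).continuous.comp (link hst).continuous)
  | ih A =>
    rw [boundaryL_coe]
    conv_rhs => rw [link, ContinuousLinearMap.completion_apply_coe, boundaryL_coe]
    change ((link (Nat.succ_le_succ hst)).toLinearMap ∘ₗ boundaryₗ e hU hs) A =
      (boundaryₗ e hU (hs.trans (Nat.succ_le_succ hst)) ∘ₗ (diracLink hst).toLinearMap) A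
    refine LinearMap.congr_fun (Finsupp.lhom_ext fun p β => ?_) A
    refine (congrArg (link (Nat.succ_le_succ hst)) (boundaryₗ_single e hU hs p β)).trans
      (Eq.trans ?_ (boundaryₗ_single e hU (hs.trans (Nat.succ_le_succ hst)) p β).symm)
    rw [map_sum]
    exact Finset.sum_congr rfl fun i _ => link_prederivative hs _ hU _ p.2 _

/-! ### The exterior derivative -/

variable [FiniteDimensional ℝ E]

theorem toField_apply (ω : FormSpace k r U) (x : E) (v : Fin k → E) :
    toField ω.1 x v =
      integral ω (element r U x (exteriorPower.ιMulti ℝ k v) : DiffChain k r U) := by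
  rw [integral_coe]
  rfl

/-- A linear functional on `k`-vectors as a continuous alternating form. -/
def dualToAlternating (φ : Module.Dual ℝ (⋀[ℝ]^k E)) : E [⋀^Fin k]→L[ℝ] ℝ :=
  { φ.compAlternatingMap (exteriorPower.ιMulti ℝ k) with
    cont := continuous_multilinear
      (φ.compAlternatingMap (exteriorPower.ιMulti ℝ k)).toMultilinearMap }

/-- In a basis of the `k`-vectors the field is a finite sum of fixed alternating forms, whose
coefficients are a continuous functional composed with the differentiable map `x ↦ (x; b j)`. -/
theorem differentiableAt_toField (hr : 2 ≤ r) (hU : IsOpen U) (ω : FormSpace k r U) {p : E}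
    (hp : p ∈ U) : DifferentiableAt ℝ (toField ω.1) p := by
  let b := Module.finBasis ℝ (⋀[ℝ]^k E)
  have h : toField ω.1 = fun x => ∑ j, integral ω (element r U x (b j) : DiffChain k r U) •
      dualToAlternating (b.coord j) := by
    funext x
    ext v
    rw [toField_apply, ContinuousAlternatingMap.sum_apply]
    have hL : ∀ α, integral ω (element r U x α : DiffChain k r U) =
        ((integral ω).toLinearMap ∘ₗ toDiffChain k r U ∘ₗ Sections.single x) α := fun _ => rfl
    rw [hL]
    conv_lhs => rw [← b.sum_repr (exteriorPower.ιMulti ℝ k v)]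
    rw [map_sum]
    refine Finset.sum_congr rfl fun j _ => ?_
    rw [map_smul, ← hL, smul_eq_mul, mul_comm]
    rfl
  rw [h]
  refine DifferentiableAt.fun_sum fun j _ => DifferentiableAt.smul_const ?_ _
  exact (integral ω).differentiableAt.comp p (differentiableAt_element hr hU hp (b j))

/-- A continuous functional commutes with the derivative; this is the link between `d` and the
prederivatives in `∂`. -/
theorem fderiv_toField_apply (hr : 2 ≤ r) (hU : IsOpen U) (ω : FormSpace k r U) {p : E}
    (hp : p ∈ U) (u : E) (v : Fin k → E) :
    fderiv ℝ (fun x => toField ω.1 x v) p u =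
      integral ω (prederivative r U u p (exteriorPower.ιMulti ℝ k v)) := by
  rw [funext fun x => toField_apply ω x v, prederivative_eq_fderiv hr hU hp]
  have h := ((integral ω).hasFDerivAt.comp p
    (differentiableAt_element hr hU hp (exteriorPower.ιMulti ℝ k v)).hasFDerivAt).fderiv
  exact congrArg (fun T => T u) h

/-- Stokes' theorem on Dirac chains. -/
theorem integral_boundaryₗ (hU : IsOpen U) (hs : 2 ≤ s + 1) (ω : FormSpace k (s + 1) U)
    (A : DiracChain (k + 1) s U) :
    integral ω (boundaryₗ e hU hs A) = extDer ω.1 A.toSpace := by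
  change ((integral ω).toLinearMap ∘ₗ boundaryₗ e hU hs) A =
    (extDer ω.1 ∘ₗ DiracChain.toSpace.toLinearMap) A
  refine LinearMap.congr_fun (Finsupp.lhom_ext fun p β => ?_) A
  refine (congrArg (integral ω) (boundaryₗ_single e hU hs p β)).trans
    (Eq.trans ?_ (Finsupp.lsum_single ℝ _ p β).symm)
  let F : ⋀[ℝ]^(k + 1) E →ₗ[ℝ] ℝ := (integral ω).toLinearMap ∘ₗ
    ∑ i, prederivativeₗ hs hU (e i) p ∘ₗ retraction (e i)
  have hF : integral ω (∑ i, prederivative (s + 1) U (e i) p (retraction (e i) β)) = F β := by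
    simp [F, prederivativeₗ]
  rw [hF]
  refine LinearMap.congr_fun (exteriorPower.linearMap_ext (AlternatingMap.ext fun v => ?_)) β
  simp only [LinearMap.compAlternatingMap_apply,
    exteriorPower.alternatingMapLinearEquiv_apply_ιMulti]
  have hP : ∀ u w, prederivativeₗ hs hU u p (exteriorPower.ιMulti ℝ k w) =
      prederivative (s + 1) U u p (exteriorPower.ιMulti ℝ k w) := fun _ _ => rfl
  change _ = extDeriv (toField ω.1) p v
  rw [extDeriv_apply (differentiableAt_toField hs hU ω p.2)]
  simp only [F, LinearMap.comp_apply, LinearMap.sum_apply, retraction_ιMulti, map_sum, map_smul,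
    hP, ContinuousLinearMap.coe_coe, ← fderiv_toField_apply hs hU ω p.2]
  rw [Finset.sum_comm]
  refine Finset.sum_congr rfl fun i _ => ?_
  rw [← Finset.smul_sum, ← Int.cast_smul_eq_zsmul ℝ]
  -- The sum over the basis collapses: `∑ⱼ ⟪eⱼ, vᵢ⟫ D_{eⱼ} = D_{vᵢ}`.
  conv_rhs => rw [← e.sum_repr (v i), map_sum]
  simp [e.repr_apply_apply]

/-- No coefficient of `dω` is estimated directly: on a difference chain `dω` equals the integral of
`ω` over the boundary, so the norm of `ω` times the bound for `∂` is enough. -/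
theorem extDer_mem (hU : IsOpen U) (hs : 2 ≤ s + 1) (e : OrthonormalBasis (Fin n) ℝ E)
    {ω : Module.Dual ℝ (DiracSpace k U)} (hω : ω ∈ FormSpace k (s + 1) U) :
    extDer ω ∈ FormSpace (k + 1) s U := by
  refine ⟨‖integral ⟨ω, hω⟩‖ * (n * (k + 1)), fun d => ?_⟩
  have h := integral_boundaryₗ e hU hs ⟨ω, hω⟩ (DiracChain.toSpace.symm d.chain)
  rw [LinearEquiv.apply_symm_apply] at h
  rw [← h, ← Real.norm_eq_abs, mul_assoc]
  exact ((integral ⟨ω, hω⟩).le_opNorm _).trans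
    (mul_le_mul_of_nonneg_left (norm_boundaryₗ_chain_le e hU hs d) (norm_nonneg _))

/-- Stokes' theorem for chains of finite class. -/
theorem integral_boundary (hU : IsOpen U) (hs : 2 ≤ s + 1) (ω : FormSpace k (s + 1) U)
    (hd : extDer ω.1 ∈ FormSpace (k + 1) s U) (J : DiffChain (k + 1) s U) :
    integral ω (boundary e J) = integral ⟨extDer ω.1, hd⟩ J := by
  rw [← boundaryL_apply e hU hs]
  induction J using Completion.induction_on with
  | hp =>
    exact isClosed_eq ((integral ω).continuous.comp (boundaryL e hU hs).continuous)
      (integral _).continuous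
  | ih A => rw [boundaryL_coe, integral_coe, integral_boundaryₗ]

end Boundary

theorem FormSpace.anti {s : ℕ} (h : r ≤ s) : FormSpace k s U ≤ FormSpace k r U := by
  rintro ω ⟨C, hC⟩
  exact ⟨C, fun d => hC ⟨d.σ, d.p, d.α, d.order_le.trans h, d.inside⟩⟩

theorem integral_link_of_mem {s : ℕ} (h : r ≤ s) {ω : Module.Dual ℝ (DiracSpace k U)}
    (hω : ω ∈ FormSpace k s U) (hω' : ω ∈ FormSpace k r U) (J : DiffChain k r U) :
    integral ⟨ω, hω⟩ (link h J) = integral ⟨ω, hω'⟩ J := by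
  induction J using Completion.induction_on with
  | hp =>
    exact isClosed_eq ((integral _).continuous.comp (link h).continuous) (integral _).continuous
  | ih A =>
    rw [link, ContinuousLinearMap.completion_apply_coe, integral_coe, integral_coe]
    rfl

/-! ### The inductive limit -/

namespace LimChain

theorem continuous_of (r : ℕ) : Continuous (of r : DiffChain k r U → LimChain k U) :=
  continuous_sInf_rng.2 fun _ ht => ht.2.2.2 r

instance : IsTopologicalAddGroup (LimChain k U) := topologicalAddGroup_sInf fun _ ht => ht.1

instance : ContinuousSMul ℝ (LimChain k U) := continuousSMul_sInf fun _ ht => ht.2.1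

instance : LocallyConvexSpace ℝ (LimChain k U) := LocallyConvexSpace.sInf fun _ ht => ht.2.2.1

/-- A linear map from the inductive limit to a locally convex space is continuous if it is
continuous on each step. -/
theorem continuous_of_comp {F : Type*} [AddCommGroup F] [Module ℝ F] [TopologicalSpace F]
    [IsTopologicalAddGroup F] [ContinuousSMul ℝ F] [LocallyConvexSpace ℝ F]
    (T : LimChain k U →ₗ[ℝ] F) (hT : ∀ r, Continuous fun J : DiffChain k r U => T (of r J)) :
    Continuous T :=
  -- The topology induced by `T` is one of those in the infimum that defines the limit topology.
  continuous_iff_le_induced.2 <| sInf_le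
    ⟨topologicalAddGroup_induced T, continuousSMul_induced T, .induced T,
      fun r => continuous_induced_rng.2 (hT r)⟩

theorem of_link {r s : ℕ} (h : r ≤ s) (J : DiffChain k r U) :
    of s (link h J) = of r J :=
  Module.DirectLimit.of_f

theorem exists_of (J : LimChain k U) : ∃ (r : ℕ) (x : DiffChain k r U), of r x = J :=
  Module.DirectLimit.exists_of J

theorem integralInf_of (ω : FormSpaceInf k U) (r : ℕ) (J : DiffChain k r U) :
    integralInf ω (of r J) = integral (formOfInf ω r) J :=
  Module.DirectLimit.lift_of _ _ _

variable {n : ℕ} (e : OrthonormalBasis (Fin n) ℝ E)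

theorem of_boundaryL_link (hU : IsOpen U) {r s : ℕ} (h : r ≤ s) (hr : 2 ≤ r + 1)
    (J : DiffChain (k + 1) r U) :
    of (s + 1) (boundaryL e hU (hr.trans (Nat.succ_le_succ h)) (link h J)) =
      of (r + 1) (boundaryL e hU hr J) := by
  rw [← link_boundaryL, of_link]

theorem link_link {r s t : ℕ} (h : r ≤ s) (h' : s ≤ t) (J : DiffChain k r U) :
    link h' (link h J) = link (h.trans h') J := by
  induction J using Completion.induction_on with
  | hp => exact isClosed_eq ((link _).continuous.comp (link _).continuous) (link _).continuous
  | ih A =>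
    simp only [link, ContinuousLinearMap.completion_apply_coe]
    rfl

/-- The boundary operator on the inductive limit. -/
def boundaryₗ (hU : IsOpen U) : LimChain (k + 1) U →ₗ[ℝ] LimChain k U :=
  Module.DirectLimit.lift ℝ ℕ (fun r : ℕ => DiffChain (k + 1) r U)
    (fun _ _ h => (link h).toLinearMap)
    -- Each class is first linked to the next one, since `boundaryL` starts at class `1`; this gives
    -- class `0` a boundary, of class `2`.
    (fun r => of (r + 2) ∘ₗ (boundaryL e hU (s := r + 1) (by lia)).toLinearMap ∘ₗ
      (link r.le_succ).toLinearMap)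
    (fun r s h J => by
      change of (s + 2) (boundaryL e hU _ (link s.le_succ (link h J))) =
        of (r + 2) (boundaryL e hU _ (link r.le_succ J))
      rw [link_link, ← of_boundaryL_link e hU (Nat.succ_le_succ h), link_link])

theorem boundaryₗ_of (hU : IsOpen U) (r : ℕ) (J : DiffChain (k + 1) r U) :
    boundaryₗ e hU (of r J) =
      of (r + 2) (boundaryL e hU (s := r + 1) (by lia) (link r.le_succ J)) :=
  Module.DirectLimit.lift_of _ _ _

/-- The boundary operator on the inductive limit, as a continuous linear operator. -/
def boundaryL (hU : IsOpen U) : LimChain (k + 1) U →L[ℝ] LimChain k U :=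
  ⟨boundaryₗ e hU, continuous_of_comp _ fun r => by
    simp only [boundaryₗ_of]
    exact (continuous_of _).comp
      ((DiffChains.boundaryL e hU _).continuous.comp (link _).continuous)⟩

end LimChain

end DiffChains

end

/-! ### Stokes' theorem in finite classes, in class `0` and in the limit -/

open DiffChains in
theorem mainTheorem3 {E : Type*} [NormedAddCommGroup E] [InnerProductSpace ℝ E]
    [FiniteDimensional ℝ E] {n k : ℕ} (e : OrthonormalBasis (Fin n) ℝ E) (hk : k + 1 ≤ n)
    {U : Set E} (hU : IsOpen U) :
    -- finite classes: chains of class `B^s`, forms of class `B^(s+1)`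
    (∀ s : ℕ, 1 ≤ s →
      -- the limits that define `∂` on Dirac chains exist
      (∀ (v p : E) (α : ⋀[ℝ]^k E), p ∈ U →
        Tendsto (fun t : ℝ => (diffQuotient (s + 1) U v p α t : DiffChain k (s + 1) U))
          (𝓝[≠] 0) (𝓝 (prederivative (s + 1) U v p α))) ∧
      -- `∂` is a continuous linear operator that extends the boundary of Dirac chains
      (∃ D : DiffChain (k + 1) s U →L[ℝ] DiffChain k (s + 1) U,
        (∀ J, D J = boundary e J) ∧
        ∀ A : DiracChain (k + 1) s U, D (A : DiffChain (k + 1) s U) = boundaryDirac e A) ∧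
      -- `d` maps forms of class `B^(s+1)` to forms of class `B^s`
      (∀ ω ∈ FormSpace k (s + 1) U, ∀ p ∈ U, DifferentiableAt ℝ (toField ω) p) ∧
      ∃ hd : ∀ ω ∈ FormSpace k (s + 1) U, extDer ω ∈ FormSpace (k + 1) s U,
        ∀ (J : DiffChain (k + 1) s U) (ω : FormSpace k (s + 1) U),
          integral ω (boundary e J) = integral ⟨extDer ω.1, hd ω.1 ω.2⟩ J) ∧
    -- chains of class `B^0`: their boundary is of class `B^2`, and forms of class `B^2` are needed
    (∃ hd : ∀ ω ∈ FormSpace k (1 + 1) U, extDer ω ∈ FormSpace (k + 1) 0 U,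
      ∀ (J : DiffChain (k + 1) 0 U) (ω : FormSpace k (1 + 1) U),
        integral ω (boundary e (link zero_le_one J)) = integral ⟨extDer ω.1, hd ω.1 ω.2⟩ J) ∧
    -- class `B^∞`: the inductive limit of chains and the intersection of the form spaces
    (∃ D : LimChain (k + 1) U →L[ℝ] LimChain k U,
      (∀ s : ℕ, 1 ≤ s → ∀ J : DiffChain (k + 1) s U,
        D (LimChain.of s J) = LimChain.of (s + 1) (boundary e J)) ∧
      ∃ hd : ∀ ω ∈ FormSpaceInf k U, extDer ω ∈ FormSpaceInf (k + 1) U,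
        ∀ (J : LimChain (k + 1) U) (ω : FormSpaceInf k U),
          integralInf ω (D J) = integralInf ⟨extDer ω.1, hd ω.1 ω.2⟩ J) := by
  have hb : ∀ {s : ℕ}, 1 ≤ s → 2 ≤ s + 1 := fun hs => Nat.succ_le_succ hs
  refine ⟨fun s hs => ⟨fun v p α hp => tendsto_diffQuotient (hb hs) hU hp v α,
    ⟨boundaryL e hU (hb hs), boundaryL_apply e hU (hb hs), fun A => ?_⟩,
    fun ω hω p hp => differentiableAt_toField (hb hs) hU ⟨ω, hω⟩ hp,
    fun ω hω => extDer_mem hU (hb hs) e hω,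
    fun J ω => integral_boundary e hU (hb hs) ω _ J⟩, ?_, ?_⟩
  · rw [boundaryL_coe, boundaryDirac_eq e hU (hb hs)]
  · refine ⟨fun ω hω => FormSpace.anti zero_le_one (extDer_mem hU le_rfl e hω), fun J ω => ?_⟩
    rw [integral_boundary e hU le_rfl ω (extDer_mem hU le_rfl e ω.2), integral_link_of_mem]
  · refine ⟨LimChain.boundaryL e hU, fun s hs J => ?_, fun ω hω => ?_, fun J ω => ?_⟩
    -- The limit operator passes through class `s + 1`; compatibility with links removes this
    -- detour.
    · rw [← boundaryL_apply e hU (hb hs), ← LimChain.of_boundaryL_link e hU s.le_succ]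
      exact LimChain.boundaryₗ_of e hU s J
    -- Class `r` is reached from `ω` of class `r + 2` through `dω` of class `r + 1`, so that `r = 0`
    -- is covered as well.
    · refine (Submodule.mem_iInf _).2 fun r => FormSpace.anti r.le_succ ?_
      exact extDer_mem hU (by lia) e ((Submodule.mem_iInf _).1 hω (r + 1 + 1))
    · obtain ⟨r, J, rfl⟩ := LimChain.exists_of J
      rw [LimChain.integralInf_of]
      refine (congrArg (integralInf ω) (LimChain.boundaryₗ_of e hU r J)).trans ?_
      have hω : extDer ω.1 ∈ FormSpace (k + 1) (r + 1) U :=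
        extDer_mem hU (by lia) e (formOfInf ω (r + 1 + 1)).2
      rw [LimChain.integralInf_of, boundaryL_apply]
      refine (integral_boundary e hU (by lia) (formOfInf ω (r + 1 + 1)) hω _).trans ?_
      exact integral_link_of_mem r.le_succ hω _ J
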